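/- For a topological space \(Z\), the natural order on \(Z\) is given by \(x\le y\) iff the principal ultrafilter at \(x\) converges to \(y\), i.e. iff every open neighbourhood of \(y\) contains \(x\). Let \(X\) be a \(T_0\)-space which is a topological \(\bigwedge\)-semilattice: \(X\) is complete in its natural order and, for every set \(I\), the infimum map \(\bigwedge\colon X^I\to X\) is continuous. For a set or space \(Z\) let \(UZ\) be the set of ultrafilters on \(Z\), and for a map \(h\) let \(Uh\) be the push-forward of ultrafilters along \(h\); write \(\mathfrak z\rightsquigarrow z\) if \(\mathfrak z\) converges to \(z\). If \(Z\) is a space, topologise \(UZ\) by the basic open sets \(\{\mathfrak z\mid V\in\mathfrak z\}\), \(V\subseteq Z\) open. Assume that binary infima preserve smallest convergence points in \(X\): the monotone map \(X\to UX\) sending a point to its principal ultrafilter has a left adjoint \(\sigma\colon UX\to X\) with respect to the natural orders (so \(\sigma(\mathfrak x)\) is the smallest convergence point of \(\mathfrak x\)), and \(\sigma(U{\wedge}(\mathfrak z))=\sigma(U\pi_1(\mathfrak z))\wedge\sigma(U\pi_2(\mathfrak z))\) for every ultrafilter \(\mathfrak z\) on \(X\times X\), where \(\pi_1,\pi_2\colon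 X\times X\to X\) are the projections. Assume moreover that the ordered set \(X\) is a frame. The lax comma category \(\mathsf{Top}\Downarrow X\) has as objects the pairs \((A,\alpha)\) of a topological space \(A\) and a continuous map \(\alpha\colon A\to X\), and as morphisms \((A,\alpha)\to(B,\beta)\) the continuous maps \(f\colon A\to B\) with \(\alpha(a)\le\beta(f(a))\) for all \(a\in A\). A morphism \(p\colon E\to B\) of a category \(\mathsf C\) with pullbacks is effective for descent if the change-of-base functor \(p^*\colon\mathsf C/B\to\mathsf C/E\) is monadic. Theorem. A morphism \(f\colon(A,\alpha)\to(B,\beta)\) of \(\mathsf{Top}\Downarrow X\) is effective for descent in \(\mathsf{Top}\Downarrow X\) if and only if 1. \(f\colon A\to B\) is effective for descent in \(\mathsf{Top}\), and 2. for every ultrafilter \(\mathfrak b\) on \(B\) and every \(b\in B\) with \(\mathfrak b\rightsquigarrow b\), \[ \sigma(U\beta(\mathfrak b))=\bigvee\{\sigma(U\alpha(\mathfrak a))\mid \mathfrak a\in UA,\ a\in A,\ \mathfrak a\rightsquigarrow a,\ Uf(\mathfrak a)=\mathfrak b,\ f(a)=b\}. \] -/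

import Mathlib

open CategoryTheory CategoryTheory.Limits Topology

universe u

/-! ### Effective descent morphisms -/

/-- A morphism `p : E ⟶ B` is effective for descent if pullbacks along `p` exist and the change of
base functor `p^* : Over B ⥤ Over E` is monadic: the comparison functor from `Over B` to the
category of Eilenberg-Moore algebras of the monad on `Over E` induced by the adjunction
`p_! ⊣ p^*` is an equivalence of categories. -/
def IsEffectiveDescent {C : Type*} [Category C] {E B : C} (p : E ⟶ B) : Prop :=
  ∃ _ : HasPullbacksAlong p, (Monad.comparison (Over.mapPullbackAdj p)).IsEquivalence

/-! ### The lax comma category over a space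

The natural order of a space has `x` below `y` iff the principal filter at `x` converges to `y`,
that is, iff every open neighbourhood of `y` contains `x`; this is the relation `x ⤳ y`. -/

/-- The natural order, `x ⤳ y`, says that the principal ultrafilter at `x` converges to `y`. -/
theorem specializes_iff_pure_converges {X : Type u} [TopologicalSpace X] (x y : X) :
    x ⤳ y ↔ ((pure x : Ultrafilter X) : Filter X) ≤ 𝓝 y := by
  rw [specializes_iff_pure, Ultrafilter.coe_pure]

/-- An object of the lax comma category over `X`: a space together with a continuous map to `X`. -/
structure LaxCommaTop (X : Type u) [TopologicalSpace X] where
  /-- the underlying space -/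
  space : TopCat.{u}
  /-- the structure map -/
  toBase : C(space, X)

namespace LaxCommaTop

variable {X : Type u} [TopologicalSpace X]

/-- A morphism `(A, α) ⟶ (B, β)`: a continuous map `f` with `α ≤ β ∘ f` pointwise in the natural
order of `X`. -/
@[ext]
structure Hom (A B : LaxCommaTop X) where
  /-- the underlying continuous map -/
  map : A.space ⟶ B.space
  /-- the inequality `α ≤ β ∘ f` -/
  le : ∀ a : A.space, A.toBase a ⤳ B.toBase (map a)

instance : Category (LaxCommaTop X) where
  Hom := Hom
  id A := ⟨𝟙 A.space, fun _ => specializes_rfl⟩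
  comp f g := ⟨f.map ≫ g.map, fun a => (f.le a).trans (g.le (f.map a))⟩

end LaxCommaTop

/-! ### Conditions on the base space -/

/-- `X` is a topological `⋀`-semilattice: the given complete order is the natural order of `X` (in
particular, `X` is a T0-space), and, for every set `I`, the infimum map `X^I → X` is continuous. -/
structure IsTopologicalInfSemilattice (X : Type u) [TopologicalSpace X] [CompleteLattice X] :
    Prop where
  /-- the order is the natural order -/
  le_iff_specializes : ∀ x y : X, x ≤ y ↔ x ⤳ y
  /-- infima of all families are continuous -/
  continuous_iInf : ∀ I : Type u, Continuous fun x : I → X => ⨅ i, x i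

/-- The natural order of the space of all ultrafilters on `X`, whose topology is generated by the
sets `{𝔵 | V ∈ 𝔵}` with `V` open in `X`. -/
def UltrafilterLE {X : Type u} [TopologicalSpace X] (𝔵 𝔶 : Ultrafilter X) : Prop :=
  ∀ V : Set X, IsOpen V → V ∈ 𝔶 → V ∈ 𝔵

/-- An ultrafilter is below the principal ultrafilter at `z` iff it converges to `z`. -/
theorem ultrafilterLE_pure_iff {X : Type u} [TopologicalSpace X] (𝔵 : Ultrafilter X) (z : X) :
    UltrafilterLE 𝔵 (pure z) ↔ (𝔵 : Filter X) ≤ 𝓝 z := by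
  rw [(nhds_basis_opens z).ge_iff]
  constructor
  · rintro h V ⟨hz, hV⟩
    exact h V hV hz
  · intro h V hV hz
    exact h V ⟨hz, hV⟩

/-- `σ` is left adjoint to the unit `z ↦ pure z` from `X` to its space of ultrafilters, for the
natural orders. So `σ 𝔵` is the smallest convergence point of `𝔵`, and `σ` is unique. -/
def IsLeftAdjointOfUnit {X : Type u} [TopologicalSpace X] [LE X] (σ : Ultrafilter X → X) : Prop :=
  ∀ (𝔵 : Ultrafilter X) (z : X), σ 𝔵 ≤ z ↔ UltrafilterLE 𝔵 (pure z)

/-- Binary infima preserve smallest convergence points in `X`: the map `σ` is left adjoint to the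
unit `X → UX`, and `σ (U∧ (𝔷)) = σ (Uπ₁ (𝔷)) ∧ σ (Uπ₂ (𝔷))` for every ultrafilter `𝔷` on `X × X`. -/
structure BinaryInfPreservesSmallestConvergencePoints {X : Type u} [TopologicalSpace X]
    [SemilatticeInf X] (σ : Ultrafilter X → X) : Prop where
  /-- `σ` picks smallest convergence points -/
  isLeftAdjointOfUnit : IsLeftAdjointOfUnit σ
  /-- compatibility of `σ` with binary infima -/
  map_inf : ∀ 𝔷 : Ultrafilter (X × X),
    σ (𝔷.map fun p => p.1 ⊓ p.2) = σ (𝔷.map Prod.fst) ⊓ σ (𝔷.map Prod.snd)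

/-!
The theorem compares descent in the lax comma category over `X` with descent of spaces. Both sides
are first freed of the chosen pullbacks and of the comparison functor (`isEffectiveDescent_iff`):
`p : E ⟶ B` is effective for descent iff pullbacks along `p` exist, morphisms over `B` are the
morphisms on the pullbacks that ignore the component in `E` (`DescendsMorphisms`), and every object
over `E` with an action of `E ×_B E`, given on generalized elements, is a pullback
(`DescendsObjects`).

In the lax comma category, the pullback of `(Q, κ)` along `f : (A, α) ⟶ (B, β)` is the pullback of
spaces with structure map `κ ⊓ α`. Spaces over `A.space` are embedded as objects over `(A, α)` by
giving them the initial structure map, and spaces `T` become test objects `(T, ⊥)`; so descent along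
`f` implies descent along `f.map`.

For the converse, let `D` be a descent datum with structure map `c`, and let `f.map` provide its
quotient `k : D → Q`. The structure map of `Q` has to be `κ q = ⨆ c x`, over the `x` with `k x = q`.
The frame law gives `c = κ ⊓ α`, and what remains is that `κ` is continuous. In terms of smallest
convergence points this means `σ (κ 𝔮) ≤ κ q` whenever `𝔮` converges to `q`. Now `σ (κ 𝔮)` is below
`σ (β π 𝔮)`, which the second condition writes as the supremum of the `σ (α 𝔞)` for the lifts `𝔞` of
`π 𝔮`. By the frame law it suffices to bound each `σ (κ 𝔮) ⊓ σ (α 𝔞)`; as `𝔮` and `𝔞` are the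
projections of an ultrafilter `𝔴` on `D`, and `σ` preserves binary infima, this is `σ (c 𝔴)`, and
`c` is continuous (`LaxCommaTop.descendsObjects_of_map`).

The second condition is necessary: given `𝔟` converging to `b`, let `Z` be the discrete space
underlying `B` with one more point to which `𝔟` converges, and let `s` be the supremum in the
condition. On the pullback of `Z` the map equal to `α` over the discrete part, and to `α ⊓ s` over
the additional point, is continuous and a descent datum. A structure map from which it descends is
at least `β` on the discrete part and at most `s` at the additional point, so its continuity gives
`σ (β 𝔟) ≤ s` (`LaxCommaTop.liftsConvergence_of_descends`).
-/

universe v w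

/-! ### Effective descent through generalized elements -/

section GeneralizedElements

variable {C : Type w} [Category.{v} C] {E B : C}

/-- A descent datum along `p : E ⟶ B`: an object `d : D ⟶ E` over `E` on which `E ×_B E` acts. The
action is given on generalized elements: `act x e` moves the element `x` of `D` into the fibre over
`e`, whenever `d x` and `e` have the same image in `B`. No choice of pullbacks is involved, and if
pullbacks along `p` exist, these are the algebras of the monad that `p` induces on `Over E`. -/
structure DescentDatum (p : E ⟶ B) where
  /-- the total object -/
  obj : C
  /-- its structure morphism -/
  hom : obj ⟶ E
  /-- transport of an element of `obj` along a pair of elements of `E` with the same image -/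
  act : ∀ {T : C} (x : T ⟶ obj) (e : T ⟶ E), x ≫ hom ≫ p = e ≫ p → (T ⟶ obj)
  act_hom : ∀ {T : C} (x : T ⟶ obj) (e : T ⟶ E) (h : x ≫ hom ≫ p = e ≫ p),
    act x e h ≫ hom = e
  comp_act : ∀ {S T : C} (t : S ⟶ T) (x : T ⟶ obj) (e : T ⟶ E) (h : x ≫ hom ≫ p = e ≫ p),
    t ≫ act x e h = act (t ≫ x) (t ≫ e) (by simp only [Category.assoc, h])
  act_self : ∀ {T : C} (x : T ⟶ obj), act x (x ≫ hom) (by simp only [Category.assoc]) = x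
  act_act : ∀ {T : C} (x : T ⟶ obj) (e e' : T ⟶ E) (h : x ≫ hom ≫ p = e ≫ p)
    (h' : act x e h ≫ hom ≫ p = e' ≫ p) (h'' : x ≫ hom ≫ p = e' ≫ p),
    act (act x e h) e' h' = act x e' h''

/-- Morphisms over `B` are the morphisms on the pullbacks along `p` that do not depend on the
component in `E`; this says that the comparison functor is fully faithful. -/
def DescendsMorphisms (p : E ⟶ B) : Prop :=
  ∀ {P Q Q' : C} {k : P ⟶ Q} {d : P ⟶ E} {π : Q ⟶ B} (π' : Q' ⟶ B), IsPullback k d π p →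
    ∀ w : P ⟶ Q', w ≫ π' = k ≫ π →
      (∀ {T : C} (x y : T ⟶ P), x ≫ k = y ≫ k → x ≫ w = y ≫ w) →
        ∃! v : Q ⟶ Q', v ≫ π' = π ∧ k ≫ v = w

/-- Every descent datum along `p` is the pullback of an object over `B`; this says that the
comparison functor is essentially surjective. -/
def DescendsObjects (p : E ⟶ B) : Prop :=
  ∀ D : DescentDatum p, ∃ (Q : C) (π : Q ⟶ B) (k : D.obj ⟶ Q), IsPullback k D.hom π p ∧
    ∀ {T : C} (x : T ⟶ D.obj) (e : T ⟶ E) (h : x ≫ D.hom ≫ p = e ≫ p), D.act x e h ≫ k = x ≫ k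

namespace DescentDatum

variable {p : E ⟶ B}

theorem act_congr (D : DescentDatum p) {T : C} {x x' : T ⟶ D.obj} {e e' : T ⟶ E} (hx : x = x')
    (he : e = e') (h : x ≫ D.hom ≫ p = e ≫ p) :
    D.act x e h = D.act x' e' (by rw [← hx, ← he, h]) := by
  subst hx he; rfl

/-- The canonical descent datum on a pullback: it changes the component in `E`. -/
noncomputable def ofIsPullback {P Q : C} {k : P ⟶ Q} {d : P ⟶ E} {π : Q ⟶ B}
    (h : IsPullback k d π p) : DescentDatum p where
  obj := P
  hom := d
  act x e hx := h.lift (x ≫ k) e (by rw [Category.assoc, h.w, hx])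
  act_hom x e hx := h.lift_snd _ _ _
  comp_act t x e hx := h.hom_ext (by simp) (by simp)
  act_self x := h.hom_ext (by simp) (by simp)
  act_act x e e' _ _ _ := h.hom_ext (by simp) (by simp)

theorem comp_left_hom {X Y : Over E} (f : X ⟶ Y) {T : C} {x : T ⟶ X.left} {e : T ⟶ E}
    (h : x ≫ X.hom ≫ p = e ≫ p) : (x ≫ f.left) ≫ Y.hom ≫ p = e ≫ p := by
  rw [Category.assoc, Over.w_assoc, h]

variable [HasPullbacksAlong p]

theorem lift_id_eq_unit {D : C} (d : D ⟶ E) :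
    pullback.lift (f := d ≫ p) (g := p) (𝟙 D) d (Category.id_comp _) =
      ((Over.mapPullbackAdj p).unit.app (Over.mk d)).left := by
  rw [Over.mapPullbackAdj_unit_app]
  rfl

theorem lift_fst_fst_eq_mul {D : C} (d : D ⟶ E) :
    pullback.lift (f := d ≫ p) (g := p)
      (pullback.fst (pullback.snd (d ≫ p) p ≫ p) p ≫ pullback.fst (d ≫ p) p)
      (pullback.snd (pullback.snd (d ≫ p) p ≫ p) p)
      (by rw [Category.assoc, pullback.condition (f := d ≫ p), pullback.condition]) =
      ((Over.mapPullbackAdj p).toMonad.μ.app (Over.mk d)).left := by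
  change _ = ((Over.pullback p).map
    ((Over.mapPullbackAdj p).counit.app ((Over.map p).obj (Over.mk d)))).left
  rw [Over.mapPullbackAdj_counit_app]
  rfl

/-- The descent datum given by the universal element `m` of an action. -/
noncomputable def ofAction {D : C} (d : D ⟶ E) (m : pullback (d ≫ p) p ⟶ D)
    (m_hom : m ≫ d = pullback.snd (d ≫ p) p)
    (unit : pullback.lift (f := d ≫ p) (g := p) (𝟙 D) d (Category.id_comp _) ≫ m = 𝟙 D)
    (assoc : pullback.lift (f := d ≫ p) (g := p)
        (pullback.fst (pullback.snd (d ≫ p) p ≫ p) p ≫ pullback.fst (d ≫ p) p)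
        (pullback.snd (pullback.snd (d ≫ p) p ≫ p) p)
        (by rw [Category.assoc, pullback.condition (f := d ≫ p), pullback.condition]) ≫ m =
      pullback.lift (f := d ≫ p) (g := p) (pullback.fst (pullback.snd (d ≫ p) p ≫ p) p ≫ m)
        (pullback.snd (pullback.snd (d ≫ p) p ≫ p) p)
        (by rw [Category.assoc, reassoc_of% m_hom, pullback.condition]) ≫ m) :
    DescentDatum p where
  obj := D
  hom := d
  act x e h := pullback.lift x e h ≫ m
  act_hom x e h := by
    rw [Category.assoc, m_hom, pullback.lift_snd]
  comp_act t x e h := by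
    rw [← Category.assoc]
    congr 1
    apply pullback.hom_ext <;>
      simp only [Category.assoc, pullback.lift_fst, pullback.lift_snd]
  act_self x := by
    refine Eq.trans ?_ ((congrArg (x ≫ ·) unit).trans (Category.comp_id x))
    refine Eq.trans ?_ (Category.assoc _ _ _)
    congr 1
    apply pullback.hom_ext <;>
      simp only [Category.assoc, pullback.lift_fst, pullback.lift_snd, Category.comp_id]
  act_act x e e' h h' h'' := by
    have := congrArg (pullback.lift (pullback.lift x e h) e' (by
      rw [← h', Category.assoc, reassoc_of% m_hom]) ≫ ·) assoc
    simp only [← Category.assoc] at this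
    refine Eq.trans ?_ (this.symm.trans ?_)
    · congr 1
      apply pullback.hom_ext <;>
        simp only [Category.assoc, pullback.lift_fst, pullback.lift_snd, pullback.lift_fst_assoc]
    · congr 1
      apply pullback.hom_ext <;>
        simp only [Category.assoc, pullback.lift_fst, pullback.lift_snd, pullback.lift_fst_assoc]

/-- The descent datum of an Eilenberg-Moore algebra. -/
noncomputable def ofAlgebra (M : (Over.mapPullbackAdj p).toMonad.Algebra) : DescentDatum p :=
  ofAction (D := M.A.left) M.A.hom M.a.left (Over.w M.a)
    (by rw [lift_id_eq_unit]; exact congrArg (fun g => g.left) M.unit)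
    (by rw [lift_fst_fst_eq_mul]; exact congrArg (fun g => g.left) M.assoc)

/-- The Eilenberg-Moore algebra of a descent datum. -/
noncomputable def toAlgebra (D : DescentDatum p) : (Over.mapPullbackAdj p).toMonad.Algebra where
  A := Over.mk D.hom
  a := Over.homMk (D.act (pullback.fst (D.hom ≫ p) p) (pullback.snd (D.hom ≫ p) p)
    pullback.condition) (D.act_hom _ _ _)
  unit := by
    ext
    change ((Over.mapPullbackAdj p).unit.app (Over.mk D.hom)).left ≫ D.act _ _ _ = 𝟙 D.obj
    rw [← lift_id_eq_unit]
    refine (D.comp_act _ _ _ _).trans ?_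
    exact (D.act_congr (pullback.lift_fst _ _ _)
      ((pullback.lift_snd _ _ _).trans (Category.id_comp _).symm) _).trans (D.act_self (𝟙 _))
  assoc := by
    ext
    change ((Over.mapPullbackAdj p).toMonad.μ.app (Over.mk D.hom)).left ≫ D.act _ _ _ =
      pullback.lift (f := D.hom ≫ p) (g := p)
        (pullback.fst (pullback.snd (D.hom ≫ p) p ≫ p) p ≫ D.act _ _ _)
        (pullback.snd (pullback.snd (D.hom ≫ p) p ≫ p) p) _ ≫ D.act _ _ _
    rw [← lift_fst_fst_eq_mul]
    refine (D.comp_act _ _ _ _).trans (Eq.trans ?_ (D.comp_act _ _ _ _).symm)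
    refine (D.act_congr (pullback.lift_fst _ _ _) (pullback.lift_snd _ _ _) _).trans
      (Eq.trans ?_ (D.act_congr ((pullback.lift_fst _ _ _).trans
        (D.comp_act _ _ _ pullback.condition)) (pullback.lift_snd _ _ _) _).symm)
    exact (D.act_act _ _ _ _ _ _).symm

theorem ofAlgebra_toAlgebra_act (D : DescentDatum p) {T : C} (x : T ⟶ D.obj) (e : T ⟶ E)
    (h : x ≫ D.hom ≫ p = e ≫ p) : (ofAlgebra D.toAlgebra).act x e h = D.act x e h := by
  change pullback.lift x e h ≫ D.act (pullback.fst (D.hom ≫ p) p) (pullback.snd (D.hom ≫ p) p)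
    pullback.condition = _
  rw [D.comp_act]
  exact D.act_congr (pullback.lift_fst _ _ _) (pullback.lift_snd _ _ _) _

theorem lift_comp_map {D Q T : C} {d : D ⟶ B} {π : Q ⟶ B} (x : T ⟶ D) (e : T ⟶ E)
    (h : x ≫ d = e ≫ p) (y : D ⟶ Q) (w : (pullback.fst d p ≫ y) ≫ π = pullback.snd d p ≫ p)
    (h' : (x ≫ y) ≫ π = e ≫ p) :
    pullback.lift x e h ≫ pullback.lift (pullback.fst d p ≫ y) (pullback.snd d p) w =
      pullback.lift (x ≫ y) e h' := by
  apply pullback.hom_ext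
  · simp only [Category.assoc, pullback.lift_fst, pullback.lift_fst_assoc]
  · simp only [Category.assoc, pullback.lift_snd]

theorem ofAlgebra_comparison_act {Q : C} (π : Q ⟶ B) {T : C} (x : T ⟶ pullback π p) (e : T ⟶ E)
    (h : x ≫ pullback.snd π p ≫ p = e ≫ p) :
    (ofAlgebra ((Monad.comparison (Over.mapPullbackAdj p)).obj (Over.mk π))).act x e h =
      pullback.lift (f := π) (x ≫ pullback.fst π p) e
        (by rw [← h, Category.assoc, pullback.condition]) := by
  change pullback.lift x e h ≫
    ((Over.pullback p).map ((Over.mapPullbackAdj p).counit.app (Over.mk π))).left = _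
  rw [Over.mapPullbackAdj_counit_app]
  exact lift_comp_map _ _ _ _ _ _

theorem act_comp_hom_left {M N : (Over.mapPullbackAdj p).toMonad.Algebra} (f : M ⟶ N) {T : C}
    (x : T ⟶ M.A.left) (e : T ⟶ E) (h : x ≫ M.A.hom ≫ p = e ≫ p) :
    (ofAlgebra M).act x e h ≫ f.f.left =
      (ofAlgebra N).act (x ≫ f.f.left) e (comp_left_hom f.f h) := by
  have := congrArg (fun g => pullback.lift x e h ≫ g.left) f.h
  refine (Category.assoc _ _ _).trans (this.symm.trans ?_)
  refine (Category.assoc _ _ _).symm.trans (congrArg (· ≫ N.a.left) ?_)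
  exact lift_comp_map _ _ _ _ _ _

/-- An equivariant morphism over `E` is a morphism of algebras. -/
theorem map_comp_eq_of_equivariant {M N : (Over.mapPullbackAdj p).toMonad.Algebra} (f : M.A ⟶ N.A)
    (hf : ∀ {T : C} (x : T ⟶ M.A.left) (e : T ⟶ E) (h : x ≫ M.A.hom ≫ p = e ≫ p),
      (ofAlgebra M).act x e h ≫ f.left =
        (ofAlgebra N).act (x ≫ f.left) e (comp_left_hom f h)) :
    (Over.mapPullbackAdj p).toMonad.map f ≫ N.a = M.a ≫ f := by
  ext
  have := hf (pullback.fst (M.A.hom ≫ p) p) (pullback.snd (M.A.hom ≫ p) p) pullback.condition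
  refine Eq.trans this.symm ((Category.assoc _ _ _).trans ?_)
  have hid : pullback.lift (pullback.fst (M.A.hom ≫ p) p) (pullback.snd (M.A.hom ≫ p) p)
      pullback.condition = 𝟙 _ := by
    apply pullback.hom_ext
    · rw [pullback.lift_fst, Category.id_comp]
    · rw [pullback.lift_snd, Category.id_comp]
  exact (congrArg (· ≫ M.a.left ≫ f.left) hid).trans (Category.id_comp _)

end DescentDatum

open DescentDatum

variable {p : E ⟶ B}

section Comparison

variable [HasPullbacksAlong p] {Q Q' : C} {π : Q ⟶ B} {π' : Q' ⟶ B}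

/-- A morphism of algebras between pullbacks does not depend on the component in `E`. -/
theorem comp_eq_of_comparison_hom
    (f : (Monad.comparison (Over.mapPullbackAdj p)).obj (Over.mk π) ⟶
      (Monad.comparison (Over.mapPullbackAdj p)).obj (Over.mk π'))
    (g : pullback π p ⟶ pullback π' p) (hg : g = f.f.left) {T : C} (x y : T ⟶ pullback π p)
    (hxy : x ≫ pullback.fst π p = y ≫ pullback.fst π p) :
    x ≫ g ≫ pullback.fst π' p = y ≫ g ≫ pullback.fst π' p := by
  subst hg
  have h : x ≫ pullback.snd π p ≫ p = (y ≫ pullback.snd π p) ≫ p := by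
    rw [Category.assoc, ← pullback.condition, reassoc_of% hxy]
  have h1 := act_comp_hom_left f x (y ≫ pullback.snd π p) h
  have h2 : pullback.lift (f := π) (x ≫ pullback.fst π p) (y ≫ pullback.snd π p)
      (by rw [hxy, Category.assoc, Category.assoc, pullback.condition]) = y := by
    apply pullback.hom_ext
    · rw [pullback.lift_fst, hxy]
    · rw [pullback.lift_snd]
  have h3 := (congrArg (· ≫ f.f.left) ((ofAlgebra_comparison_act π x _ h).trans h2)).symm.trans h1
  have h4 := h3.trans (ofAlgebra_comparison_act π' _ _ (comp_left_hom f.f h))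
  refine (Category.assoc _ _ _).symm.trans (Eq.trans ?_ (Category.assoc _ _ _))
  refine Eq.trans ?_ (congrArg (· ≫ pullback.fst π' p) h4).symm
  exact (pullback.lift_fst _ _ _).symm

/-- Conversely, a morphism between pullbacks that does not depend on the component in `E` is a
morphism of algebras. -/
theorem exists_comparison_hom (g : pullback π p ⟶ pullback π' p)
    (hg : g ≫ pullback.snd π' p = pullback.snd π p)
    (hg' : ∀ {T : C} (x y : T ⟶ pullback π p), x ≫ pullback.fst π p = y ≫ pullback.fst π p →
      x ≫ g ≫ pullback.fst π' p = y ≫ g ≫ pullback.fst π' p) :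
    ∃ f : (Monad.comparison (Over.mapPullbackAdj p)).obj (Over.mk π) ⟶
      (Monad.comparison (Over.mapPullbackAdj p)).obj (Over.mk π'), f.f.left = g := by
  let f : ((Monad.comparison (Over.mapPullbackAdj p)).obj (Over.mk π)).A ⟶
      ((Monad.comparison (Over.mapPullbackAdj p)).obj (Over.mk π')).A := Over.homMk g hg
  refine ⟨⟨f, map_comp_eq_of_equivariant f fun {T} x e h => ?_⟩, rfl⟩
  refine (congrArg (· ≫ g) (ofAlgebra_comparison_act π x e h)).trans (Eq.trans ?_
    (ofAlgebra_comparison_act π' _ _ (comp_left_hom f h)).symm)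
  apply pullback.hom_ext
  · rw [Category.assoc, pullback.lift_fst]
    exact (hg' _ x (pullback.lift_fst _ _ _)).trans (Category.assoc _ _ _).symm
  · rw [Category.assoc, hg, pullback.lift_snd, pullback.lift_snd]

theorem comparison_map_eq_iff
    (f : (Monad.comparison (Over.mapPullbackAdj p)).obj (Over.mk π) ⟶
      (Monad.comparison (Over.mapPullbackAdj p)).obj (Over.mk π'))
    (g : pullback π p ⟶ pullback π' p) (hg : f.f.left = g) (v : Over.mk π ⟶ Over.mk π') :
    (Monad.comparison (Over.mapPullbackAdj p)).map v = f ↔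
      pullback.fst π p ≫ v.left = g ≫ pullback.fst π' p := by
  have hsnd : g ≫ pullback.snd π' p = pullback.snd π p := by
    subst hg; exact Over.w f.f
  have hv : v.left ≫ π' = π := Over.w v
  have key : (Monad.comparison (Over.mapPullbackAdj p)).map v = f ↔
      pullback.lift (pullback.fst π p ≫ v.left) (pullback.snd π p)
        (by rw [Category.assoc, hv, pullback.condition]) = g := by
    constructor
    · rintro rfl; exact hg
    · intro h
      ext
      exact h.trans hg.symm
  rw [key]
  constructor
  · rintro rfl
    rw [pullback.lift_fst]
  · intro h
    apply pullback.hom_ext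
    · rw [pullback.lift_fst, h]
    · rw [pullback.lift_snd, hsnd]

theorem full_comparison (h : DescendsMorphisms p) :
    (Monad.comparison (Over.mapPullbackAdj p)).Full where
  map_surjective {Q Q'} f := by
    -- The underlying morphism, with its source and target read as pullbacks.
    obtain ⟨g, hg⟩ : ∃ g : pullback Q.hom p ⟶ pullback Q'.hom p, g = f.f.left := ⟨_, rfl⟩
    have hsnd : g ≫ pullback.snd Q'.hom p = pullback.snd Q.hom p := by
      subst hg; exact Over.w f.f
    obtain ⟨v, ⟨hv, hv'⟩, -⟩ := h Q'.hom (IsPullback.of_hasPullback Q.hom p)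
      (g ≫ pullback.fst Q'.hom p)
      (by rw [Category.assoc, pullback.condition, pullback.condition, reassoc_of% hsnd])
      (fun x y hxy => comp_eq_of_comparison_hom f g hg x y hxy)
    exact ⟨Over.homMk v hv, (comparison_map_eq_iff f g hg.symm _).2 hv'⟩

theorem faithful_comparison (h : DescendsMorphisms p) :
    (Monad.comparison (Over.mapPullbackAdj p)).Faithful where
  map_injective {Q Q'} v v' hvv := by
    have hv := (comparison_map_eq_iff (p := p) (π := Q.hom) (π' := Q'.hom) _ _ rfl v).1 rfl
    have hv' := (comparison_map_eq_iff (p := p) (π := Q.hom) (π' := Q'.hom) _ _ rfl v').1 hvv.symm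
    obtain ⟨u, -, hu⟩ := h Q'.hom (IsPullback.of_hasPullback Q.hom p)
      (pullback.fst Q.hom p ≫ v.left) (by rw [Category.assoc, Over.w])
      (fun x y hxy => by rw [reassoc_of% hxy])
    ext
    rw [hu v.left ⟨Over.w v, rfl⟩, hu v'.left ⟨Over.w v', hv'.trans hv.symm⟩]

theorem descendsMorphisms_of_comparison [(Monad.comparison (Over.mapPullbackAdj p)).Full]
    [(Monad.comparison (Over.mapPullbackAdj p)).Faithful] : DescendsMorphisms p := by
  intro P Q Q' k d π π' hP w hw hconst
  let i := hP.isoPullback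
  obtain ⟨f, hf⟩ := exists_comparison_hom (p := p) (π := π) (π' := π')
    (pullback.lift (i.inv ≫ w) (pullback.snd π p) (by
      rw [Category.assoc, hw, hP.isoPullback_inv_fst_assoc, pullback.condition]))
    (pullback.lift_snd _ _ _) (fun x y hxy => by
      rw [pullback.lift_fst, ← Category.assoc, ← Category.assoc]
      apply hconst
      rwa [Category.assoc, Category.assoc, hP.isoPullback_inv_fst])
  have hiff : ∀ v : Over.mk π ⟶ Over.mk π',
      (Monad.comparison (Over.mapPullbackAdj p)).map v = f ↔ k ≫ v.left = w := by
    intro v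
    rw [comparison_map_eq_iff f _ hf, pullback.lift_fst, ← hP.isoPullback_inv_fst, Category.assoc]
    exact Iso.cancel_iso_inv_left i _ _
  obtain ⟨v, hv⟩ := (Monad.comparison (Over.mapPullbackAdj p)).map_surjective f
  refine ⟨v.left, ⟨Over.w v, (hiff v).1 hv⟩, ?_⟩
  rintro v' ⟨hv', hkv'⟩
  have := (hiff (Over.homMk v' hv')).2 hkv'
  exact congrArg (fun g => g.left)
    ((Monad.comparison (Over.mapPullbackAdj p)).map_injective (this.trans hv.symm))

theorem essSurj_comparison (h : DescendsObjects p) :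
    (Monad.comparison (Over.mapPullbackAdj p)).EssSurj where
  mem_essImage M := by
    obtain ⟨Q, π, k, hP, hk⟩ := h (ofAlgebra M)
    refine ⟨Over.mk π, ⟨(Monad.Algebra.isoMk (B := (Monad.comparison (Over.mapPullbackAdj p)).obj
      (Over.mk π)) (Over.isoMk hP.isoPullback hP.isoPullback_hom_snd)
      (map_comp_eq_of_equivariant _ fun {T} x e h => ?_)).symm⟩⟩
    refine Eq.trans ?_ (ofAlgebra_comparison_act π _ _ (comp_left_hom _ h)).symm
    apply pullback.hom_ext
    · refine Eq.trans ?_ (pullback.lift_fst _ _ _).symm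
      refine (Category.assoc _ _ _).trans ((congrArg (_ ≫ ·) hP.isoPullback_hom_fst).trans ?_)
      refine (hk x e h).trans (Eq.trans ?_ (Category.assoc _ _ _).symm)
      exact congrArg (x ≫ ·) hP.isoPullback_hom_fst.symm
    · refine Eq.trans ?_ (pullback.lift_snd _ _ _).symm
      refine (Category.assoc _ _ _).trans ((congrArg (_ ≫ ·) hP.isoPullback_hom_snd).trans ?_)
      exact (ofAlgebra M).act_hom x e h

theorem descendsObjects_of_comparison [(Monad.comparison (Over.mapPullbackAdj p)).EssSurj] :
    DescendsObjects p := by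
  intro D
  let Y := (Monad.comparison (Over.mapPullbackAdj p)).objPreimage D.toAlgebra
  let i := (Monad.comparison (Over.mapPullbackAdj p)).objObjPreimageIso D.toAlgebra
  let j : D.obj ≅ pullback Y.hom p :=
    (Over.forget E).mapIso ((Monad.forget _).mapIso i.symm)
  have hj : j.hom ≫ pullback.snd Y.hom p = D.hom := Over.w i.inv.f
  refine ⟨Y.left, Y.hom, j.hom ≫ pullback.fst Y.hom p,
    (IsPullback.of_hasPullback Y.hom p).of_iso j.symm (Iso.refl _) (Iso.refl _) (Iso.refl _)
      (by simp) (by simp [← hj]) (by simp) (by simp), ?_⟩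
  intro T x e h
  have h1 := act_comp_hom_left i.inv x e h
  have h2 := (congrArg (· ≫ i.inv.f.left) (ofAlgebra_toAlgebra_act D x e h)).symm.trans
    (h1.trans (ofAlgebra_comparison_act Y.hom _ _ (comp_left_hom i.inv.f h)))
  refine (Category.assoc _ _ _).symm.trans ((congrArg (· ≫ pullback.fst Y.hom p) h2).trans ?_)
  exact (pullback.lift_fst _ _ _).trans (Category.assoc _ _ _)

end Comparison

/-- Effective descent in terms of generalized elements. -/
theorem isEffectiveDescent_iff (p : E ⟶ B) : IsEffectiveDescent p ↔
    HasPullbacksAlong p ∧ DescendsMorphisms p ∧ DescendsObjects p := by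
  constructor
  · rintro ⟨_, _⟩
    exact ⟨inferInstance, descendsMorphisms_of_comparison, descendsObjects_of_comparison⟩
  · rintro ⟨_, h, h'⟩
    have := full_comparison h
    have := faithful_comparison h
    have := essSurj_comparison h'
    exact ⟨inferInstance, { }⟩

end GeneralizedElements

/-! ### Pullbacks of spaces and ultrafilters -/

section TopPullback

variable {P Q A B : TopCat.{u}} {k : P ⟶ Q} {d : P ⟶ A} {π : Q ⟶ B} {f : A ⟶ B}

theorem TopCat.isPullback_pullbackFst_pullbackSnd (π : Q ⟶ B) (f : A ⟶ B) :
    IsPullback (TopCat.pullbackFst π f) (TopCat.pullbackSnd π f) π f :=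
  IsPullback.of_isLimit (TopCat.pullbackConeIsLimit π f)

namespace CategoryTheory.IsPullback

theorem topCat_condition (h : IsPullback k d π f) (x : P) : π (k x) = f (d x) :=
  ConcreteCategory.congr_hom h.w x

theorem topCat_ext (h : IsPullback k d π f) {x y : P} (hk : k x = k y) (hd : d x = d y) :
    x = y := by
  let i := h.isoIsPullback _ _ (TopCat.isPullback_pullbackFst_pullbackSnd π f)
  have hi : Function.Injective i.hom := (TopCat.homeoOfIso i).injective
  apply hi
  have hfst (z : P) : (i.hom z).1.1 = k z := ConcreteCategory.congr_hom
    (h.isoIsPullback_hom_fst _ _ (TopCat.isPullback_pullbackFst_pullbackSnd π f)) z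
  have hsnd (z : P) : (i.hom z).1.2 = d z := ConcreteCategory.congr_hom
    (h.isoIsPullback_hom_snd _ _ (TopCat.isPullback_pullbackFst_pullbackSnd π f)) z
  apply Subtype.ext
  apply Prod.ext
  · rw [hfst, hfst, hk]
  · rw [hsnd, hsnd, hd]

theorem topCat_exists (h : IsPullback k d π f) (q : Q) (a : A) (hqa : π q = f a) :
    ∃ x : P, k x = q ∧ d x = a := by
  let i := h.isoIsPullback _ _ (TopCat.isPullback_pullbackFst_pullbackSnd π f)
  exact ⟨i.inv ⟨(q, a), hqa⟩,
    ConcreteCategory.congr_hom (h.isoIsPullback_inv_fst _ _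
      (TopCat.isPullback_pullbackFst_pullbackSnd π f)) ⟨(q, a), hqa⟩,
    ConcreteCategory.congr_hom (h.isoIsPullback_inv_snd _ _
      (TopCat.isPullback_pullbackFst_pullbackSnd π f)) ⟨(q, a), hqa⟩⟩

theorem topCat_isInducing (h : IsPullback k d π f) : IsInducing fun x : P => (k x, d x) := by
  let i := h.isoIsPullback _ _ (TopCat.isPullback_pullbackFst_pullbackSnd π f)
  have hi : IsInducing i.hom := (TopCat.homeoOfIso i).isInducing
  have := (IsInducing.subtypeVal (t := {p : Q × A | π p.1 = f p.2})).comp hi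
  convert this using 1
  funext z
  exact Prod.ext (ConcreteCategory.congr_hom (h.isoIsPullback_hom_fst _ _
      (TopCat.isPullback_pullbackFst_pullbackSnd π f)) z).symm
    (ConcreteCategory.congr_hom (h.isoIsPullback_hom_snd _ _
      (TopCat.isPullback_pullbackFst_pullbackSnd π f)) z).symm

theorem topCat_le_nhds (h : IsPullback k d π f) {l : Filter P} {x : P}
    (hk : l.map k ≤ 𝓝 (k x)) (hd : l.map d ≤ 𝓝 (d x)) : l ≤ 𝓝 x := by
  rw [h.topCat_isInducing.nhds_eq_comap, ← Filter.map_le_iff_le_comap, nhds_prod_eq]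
  exact Filter.Tendsto.prodMk hk hd

/-- Ultrafilters weakly preserve pullbacks: ultrafilters on the factors with the same image are the
projections of an ultrafilter on the pullback. -/
theorem topCat_exists_ultrafilter (h : IsPullback k d π f) (𝔮 : Ultrafilter Q) (𝔞 : Ultrafilter A)
    (hqa : 𝔮.map π = 𝔞.map f) : ∃ 𝔴 : Ultrafilter P, 𝔴.map k = 𝔮 ∧ 𝔴.map d = 𝔞 := by
  have hne : (Filter.comap k 𝔮 ⊓ Filter.comap d 𝔞).NeBot := by
    rw [Filter.inf_neBot_iff]
    rintro U ⟨S, hS, hSU⟩ V ⟨R, hR, hRV⟩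
    have h1 : π '' S ∈ 𝔞.map f := hqa ▸ Filter.image_mem_map hS
    obtain ⟨a, haR, q, hqS, hq⟩ := 𝔞.nonempty_of_mem (Filter.inter_mem hR h1)
    obtain ⟨x, rfl, rfl⟩ := h.topCat_exists q a hq
    exact ⟨x, hSU hqS, hRV haR⟩
  refine ⟨Ultrafilter.of (Filter.comap k 𝔮 ⊓ Filter.comap d 𝔞),
    Ultrafilter.eq_of_le ?_, Ultrafilter.eq_of_le ?_⟩
  · exact Filter.map_le_iff_le_comap.2 ((Ultrafilter.of_le _).trans inf_le_left)
  · exact Filter.map_le_iff_le_comap.2 ((Ultrafilter.of_le _).trans inf_le_right)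

end CategoryTheory.IsPullback

end TopPullback

/-! ### Smallest convergence points -/

section SmallestConvergencePoints

variable {X : Type u} [TopologicalSpace X] {σ : Ultrafilter X → X}

theorem IsLeftAdjointOfUnit.le_iff [LE X] (hσ : IsLeftAdjointOfUnit σ) {𝔵 : Ultrafilter X} {z : X} :
    σ 𝔵 ≤ z ↔ (𝔵 : Filter X) ≤ 𝓝 z :=
  (hσ 𝔵 z).trans (ultrafilterLE_pure_iff 𝔵 z)

theorem IsLeftAdjointOfUnit.continuous_iff [LE X] (hσ : IsLeftAdjointOfUnit σ) {Z : Type*}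
    [TopologicalSpace Z] {g : Z → X} :
    Continuous g ↔ ∀ (𝔷 : Ultrafilter Z) (z : Z), (𝔷 : Filter Z) ≤ 𝓝 z → σ (𝔷.map g) ≤ g z := by
  simp only [hσ.le_iff, continuous_iff_ultrafilter, Filter.Tendsto, Ultrafilter.coe_map]
  exact forall_comm

variable [CompleteLattice X]

theorem IsLeftAdjointOfUnit.map_mono (hX : IsTopologicalInfSemilattice X)
    (hσ : IsLeftAdjointOfUnit σ) {Z : Type*} {g h : Z → X}
    (hgh : ∀ z, g z ≤ h z) (𝔷 : Ultrafilter Z) : σ (𝔷.map g) ≤ σ (𝔷.map h) := by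
  rw [hσ.le_iff, (nhds_basis_opens _).ge_iff]
  rintro V ⟨hV, hVo⟩
  have : h ⁻¹' V ∈ 𝔷 := (hσ.le_iff.1 le_rfl : ((𝔷.map h : Ultrafilter X) : Filter X) ≤ _)
    (hVo.mem_nhds hV)
  change g ⁻¹' V ∈ (𝔷 : Filter Z)
  exact Filter.mem_of_superset this
    fun z hz => ((hX.le_iff_specializes (g z) (h z)).1 (hgh z)).mem_open hVo hz

theorem IsLeftAdjointOfUnit.apply_pure (hX : IsTopologicalInfSemilattice X)
    (hσ : IsLeftAdjointOfUnit σ) (x : X) : σ (pure x) = x := by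
  apply le_antisymm
  · exact hσ.le_iff.2 (pure_le_nhds x)
  · rw [hX.le_iff_specializes, specializes_iff_pure_converges]
    exact hσ.le_iff.1 le_rfl

end SmallestConvergencePoints

/-- Compatibility with binary infima for a pair of maps on an arbitrary set. -/
theorem BinaryInfPreservesSmallestConvergencePoints.map_inf_map {X : Type u} [TopologicalSpace X]
    [SemilatticeInf X] {σ : Ultrafilter X → X} (hσ : BinaryInfPreservesSmallestConvergencePoints σ)
    {Z : Type*} (g h : Z → X) (𝔷 : Ultrafilter Z) :
    σ (𝔷.map fun z => g z ⊓ h z) = σ (𝔷.map g) ⊓ σ (𝔷.map h) :=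
  hσ.map_inf (𝔷.map fun z => (g z, h z))

namespace LaxCommaTop

variable {X : Type u} [TopologicalSpace X]

@[simp]
theorem comp_map {A B C : LaxCommaTop X} (f : A ⟶ B) (g : B ⟶ C) : (f ≫ g).map = f.map ≫ g.map :=
  rfl

theorem hom_ext {A B : LaxCommaTop X} {f g : A ⟶ B} (h : f.map = g.map) : f = g :=
  Hom.ext h

/-! ### Pullbacks in the lax comma category -/

section Order

variable [CompleteLattice X]

theorem toBase_le (hX : IsTopologicalInfSemilattice X) {A B : LaxCommaTop X} (f : A ⟶ B)
    (a : A.space) : A.toBase a ≤ B.toBase (f.map a) :=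
  (hX.le_iff_specializes _ _).2 (Hom.le f a)

/-- A continuous map that respects the structure maps. -/
def ofLe (hX : IsTopologicalInfSemilattice X) {A B : LaxCommaTop X} (f : A.space ⟶ B.space)
    (h : ∀ a, A.toBase a ≤ B.toBase (f a)) : A ⟶ B :=
  ⟨f, fun a => (hX.le_iff_specializes _ _).1 (h a)⟩

/-- A space with a constant structure map. -/
def const (T : TopCat.{u}) (x : X) : LaxCommaTop X :=
  ⟨T, ContinuousMap.const T x⟩

/-- A space over `B.space` with the initial structure map: the largest one for which the given map
to `B` is a morphism. -/
def initial (B : LaxCommaTop X) {T : TopCat.{u}} (f : T ⟶ B.space) : LaxCommaTop X :=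
  ⟨T, B.toBase.comp f.hom⟩

/-- Every continuous map is a morphism from the space with the bottom structure map. -/
def ofBot (hX : IsTopologicalInfSemilattice X) {T : TopCat.{u}} {A : LaxCommaTop X}
    (f : T ⟶ A.space) : const T (⊥ : X) ⟶ A :=
  ofLe hX f fun _ => bot_le

variable {P Q A B : LaxCommaTop X} {k : P ⟶ Q} {d : P ⟶ A} {π : Q ⟶ B} {f : A ⟶ B}

/-- A square in the lax comma category is a pullback if it is one on the underlying spaces and the
structure map of its corner is the pointwise infimum. -/
theorem isPullback_of_map (hX : IsTopologicalInfSemilattice X)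
    (h : IsPullback k.map d.map π.map f.map)
    (hP : ∀ x, Q.toBase (k.map x) ⊓ A.toBase (d.map x) ≤ P.toBase x) : IsPullback k d π f := by
  refine ⟨⟨hom_ext h.w⟩, ⟨PullbackCone.IsLimit.mk _ (fun s => ofLe hX
    (h.lift s.fst.map s.snd.map (congrArg Hom.map s.condition)) fun t => ?_) ?_ ?_ ?_⟩⟩
  · refine le_trans (le_inf ?_ ?_) (hP _)
    · have := ConcreteCategory.congr_hom
        (h.lift_fst s.fst.map s.snd.map (congrArg Hom.map s.condition)) t
      exact (toBase_le hX s.fst t).trans_eq (congrArg Q.toBase this.symm)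
    · have := ConcreteCategory.congr_hom
        (h.lift_snd s.fst.map s.snd.map (congrArg Hom.map s.condition)) t
      exact (toBase_le hX s.snd t).trans_eq (congrArg A.toBase this.symm)
  · exact fun s => hom_ext (h.lift_fst _ _ _)
  · exact fun s => hom_ext (h.lift_snd _ _ _)
  · intro s m hk hd
    exact hom_ext (h.hom_ext ((congrArg Hom.map hk).trans (h.lift_fst _ _ _).symm)
      ((congrArg Hom.map hd).trans (h.lift_snd _ _ _).symm))

/-- The forgetful functor to spaces preserves pullbacks, since it has the left adjoint
`T ↦ const T ⊥`. -/
theorem isPullback_map (hX : IsTopologicalInfSemilattice X) (h : IsPullback k d π f) :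
    IsPullback k.map d.map π.map f.map := by
  refine ⟨⟨congrArg Hom.map h.w⟩, ⟨PullbackCone.IsLimit.mk _ (fun s => (h.lift
    (ofBot hX s.fst) (ofBot hX s.snd) (hom_ext s.condition)).map) ?_ ?_ ?_⟩⟩
  · exact fun s => congrArg Hom.map (h.lift_fst (ofBot hX s.fst) (ofBot hX s.snd) _)
  · exact fun s => congrArg Hom.map (h.lift_snd (ofBot hX s.fst) (ofBot hX s.snd) _)
  · intro s m hk hd
    refine congrArg Hom.map (show ofBot hX m = _ from h.hom_ext ?_ ?_)
    · exact (hom_ext hk).trans (h.lift_fst (ofBot hX s.fst) (ofBot hX s.snd) _).symm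
    · exact (hom_ext hd).trans (h.lift_snd (ofBot hX s.fst) (ofBot hX s.snd) _).symm

theorem inf_le_of_isPullback (hX : IsTopologicalInfSemilattice X) (h : IsPullback k d π f)
    (x : P.space) : Q.toBase (k.map x) ⊓ A.toBase (d.map x) ≤ P.toBase x := by
  let T : LaxCommaTop X :=
    const (TopCat.of PUnit) (Q.toBase (k.map x) ⊓ A.toBase (d.map x))
  let y : T.space ⟶ P.space := TopCat.ofHom (.const _ x)
  let q : T ⟶ Q := ofLe hX (y ≫ k.map) fun _ => inf_le_left
  let a : T ⟶ A := ofLe hX (y ≫ d.map) fun _ => inf_le_right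
  have w : q ≫ π = a ≫ f := hom_ext (by
    change (y ≫ k.map) ≫ π.map = (y ≫ d.map) ≫ f.map
    rw [Category.assoc, Category.assoc, ← comp_map, h.w, comp_map])
  have hy : (h.lift q a w).map = y := (isPullback_map hX h).hom_ext
    (congrArg Hom.map (h.lift_fst q a w)) (congrArg Hom.map (h.lift_snd q a w))
  have := toBase_le hX (h.lift q a w) PUnit.unit
  rw [hy] at this
  exact this

theorem hasPullbacksAlong {σ : Ultrafilter X → X} (hX : IsTopologicalInfSemilattice X)
    (hσ : BinaryInfPreservesSmallestConvergencePoints σ) (f : A ⟶ B) : HasPullbacksAlong f := by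
  intro Q π
  have h := TopCat.isPullback_pullbackFst_pullbackSnd π.map f.map
  let c : C(TopCat.of {p : Q.space × A.space // π.map p.1 = f.map p.2}, X) :=
    ⟨fun x => Q.toBase (TopCat.pullbackFst π.map f.map x) ⊓
      A.toBase (TopCat.pullbackSnd π.map f.map x), by
      rw [hσ.isLeftAdjointOfUnit.continuous_iff]
      intro 𝔷 z hz
      rw [hσ.map_inf_map]
      exact inf_le_inf (hσ.isLeftAdjointOfUnit.continuous_iff.1 (by fun_prop) 𝔷 z hz)
        (hσ.isLeftAdjointOfUnit.continuous_iff.1 (by fun_prop) 𝔷 z hz)⟩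
  let P : LaxCommaTop X := ⟨_, c⟩
  let k : P ⟶ Q := ofLe hX (TopCat.pullbackFst π.map f.map) fun _ => inf_le_left
  let d : P ⟶ A := ofLe hX (TopCat.pullbackSnd π.map f.map) fun _ => inf_le_right
  exact (isPullback_of_map (k := k) (d := d) hX h fun _ => le_rfl).hasPullback

end Order

end LaxCommaTop

namespace LaxCommaTop

/-! ### Descent of the underlying map -/

section Underlying

variable {X : Type u} [TopologicalSpace X] [CompleteLattice X]
  {A B : LaxCommaTop X} {f : A ⟶ B}

theorem descendsMorphisms_map (hX : IsTopologicalInfSemilattice X) (h : DescendsMorphisms f) :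
    DescendsMorphisms f.map := by
  intro P Q Q' k d π π' hP w hw hc
  have hkd (x : P) : B.toBase (π (k x)) = B.toBase (f.map (d x)) :=
    congrArg B.toBase (hP.topCat_condition x)
  have hw' (x : P) : B.toBase (π' (w x)) = B.toBase (f.map (d x)) :=
    (congrArg B.toBase (ConcreteCategory.congr_hom hw x)).trans (hkd x)
  let k' : initial A d ⟶ initial B π :=
    ofLe hX k fun x => (toBase_le hX f (d x)).trans_eq (hkd x).symm
  let d' : initial A d ⟶ A := ofLe hX d fun _ => le_rfl
  let π₁ : initial B π ⟶ B := ofLe hX π fun _ => le_rfl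
  let π₁' : initial B π' ⟶ B := ofLe hX π' fun _ => le_rfl
  let w' : initial A d ⟶ initial B π' :=
    ofLe hX w fun x => (toBase_le hX f (d x)).trans_eq (hw' x).symm
  have hP' : IsPullback k' d' π₁ f := isPullback_of_map hX hP fun _ => inf_le_right
  obtain ⟨v, ⟨hv, hkv⟩, hu⟩ := h π₁' hP' w' (hom_ext hw)
    fun x y hxy => hom_ext (hc x.map y.map (congrArg Hom.map hxy))
  refine ⟨v.map, ⟨congrArg Hom.map hv, congrArg Hom.map hkv⟩, ?_⟩
  rintro v₁ ⟨hv₁, hkv₁⟩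
  let v₁' : initial B π ⟶ initial B π' := ofLe hX v₁ fun x =>
    (congrArg B.toBase (ConcreteCategory.congr_hom hv₁ x)).ge
  exact congrArg Hom.map (hu v₁' ⟨hom_ext hv₁, hom_ext hkv₁⟩)

/-- A descent datum of spaces with a structure map that is compatible with transport. -/
def liftDescentDatum (hX : IsTopologicalInfSemilattice X) (D : DescentDatum f.map) (c : C(D.obj, X))
    (hc : ∀ x, c x ≤ A.toBase (D.hom x))
    (hact : ∀ {T : TopCat.{u}} (x : T ⟶ D.obj) (e : T ⟶ A.space)
      (h : x ≫ D.hom ≫ f.map = e ≫ f.map) (t : T),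
      c (x t) ⊓ A.toBase (e t) ≤ c (D.act x e h t)) : DescentDatum f where
  obj := ⟨D.obj, c⟩
  hom := ofLe hX D.hom hc
  act x e h := ofLe hX (D.act x.map e.map (congrArg Hom.map h)) fun t =>
    (le_inf (toBase_le hX x t) (toBase_le hX e t)).trans (hact x.map e.map _ t)
  act_hom x e h := hom_ext (D.act_hom x.map e.map (congrArg Hom.map h))
  comp_act t x e h := hom_ext (D.comp_act t.map x.map e.map (congrArg Hom.map h))
  act_self x := hom_ext (D.act_self x.map)
  act_act x e e' h h' h'' := hom_ext (D.act_act x.map e.map e'.map (congrArg Hom.map h)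
    (congrArg Hom.map h') (congrArg Hom.map h''))

theorem descendsObjects_map (hX : IsTopologicalInfSemilattice X) (h : DescendsObjects f) :
    DescendsObjects f.map := by
  intro D
  obtain ⟨Q, π, k, hP, hk⟩ := h (liftDescentDatum hX D (A.toBase.comp D.hom.hom)
    (fun _ => le_rfl) fun x e h t => inf_le_right.trans_eq
      (congrArg A.toBase (ConcreteCategory.congr_hom (D.act_hom x e h) t).symm))
  refine ⟨Q.space, π.map, k.map, isPullback_map hX hP, fun {T} x e he => ?_⟩
  exact congrArg Hom.map (hk (ofBot hX x) (ofBot hX e) (hom_ext he))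

/-- The descent datum of spaces underlying a descent datum. -/
def mapDescentDatum (hX : IsTopologicalInfSemilattice X) (D : DescentDatum f) :
    DescentDatum f.map where
  obj := D.obj.space
  hom := D.hom.map
  act x e h := (D.act (ofBot hX x) (ofBot hX e) (hom_ext h)).map
  act_hom x e _ := congrArg Hom.map (D.act_hom (ofBot hX x) (ofBot hX e) _)
  comp_act {_ T} t x e h := congrArg Hom.map
    (D.comp_act (ofBot hX (A := const T ⊥) t) (ofBot hX x) (ofBot hX e) (hom_ext h))
  act_self x := congrArg Hom.map (D.act_self (ofBot hX x))
  act_act x e e' h h' h'' := congrArg Hom.map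
    (D.act_act (ofBot hX x) (ofBot hX e) (ofBot hX e') (hom_ext h) (hom_ext h') (hom_ext h''))

theorem map_act (hX : IsTopologicalInfSemilattice X) (D : DescentDatum f) {T : LaxCommaTop X}
    (x : T ⟶ D.obj) (e : T ⟶ A) (h : x ≫ D.hom ≫ f = e ≫ f) :
    (D.act x e h).map = (mapDescentDatum hX D).act x.map e.map (congrArg Hom.map h) :=
  congrArg Hom.map (D.comp_act (ofBot hX (𝟙 T.space)) x e h)

end Underlying

variable {X : Type u} [TopologicalSpace X] [Order.Frame X] {σ : Ultrafilter X → X}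
  {A B : LaxCommaTop X} {f : A ⟶ B}

/-! ### Sufficiency of the two conditions -/

/-- Points `x` and `y` in the same fibre of the quotient map `k` are related by transport, which
bounds the structure map at `y` from below by its value at `x`. The transport is applied to a
one-point object whose structure map is the left-hand side. -/
theorem inf_le_of_descentDatum (hX : IsTopologicalInfSemilattice X) (D : DescentDatum f)
    {Q : TopCat.{u}} {π : Q ⟶ B.space} {k : D.obj.space ⟶ Q}
    (hP : IsPullback k D.hom.map π f.map)
    (hk : ∀ {T : TopCat.{u}} (x : T ⟶ D.obj.space) (e : T ⟶ A.space)
      (h : x ≫ D.hom.map ≫ f.map = e ≫ f.map), (mapDescentDatum hX D).act x e h ≫ k = x ≫ k)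
    (x y : D.obj.space) (hxy : k x = k y) :
    A.toBase (D.hom.map y) ⊓ D.obj.toBase x ≤ D.obj.toBase y := by
  let T : LaxCommaTop X :=
    const (TopCat.of PUnit) (A.toBase (D.hom.map y) ⊓ D.obj.toBase x)
  let x' : T ⟶ D.obj := ofLe hX (TopCat.ofHom (.const _ x)) fun _ => inf_le_right
  let e : T ⟶ A := ofLe hX (TopCat.ofHom (.const _ (D.hom.map y))) fun _ => inf_le_left
  have h : x' ≫ D.hom ≫ f = e ≫ f := by
    apply hom_ext
    ext t
    change f.map (D.hom.map x) = f.map (D.hom.map y)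
    rw [← hP.topCat_condition, ← hP.topCat_condition, hxy]
  have hy : (D.act x' e h).map PUnit.unit = y := by
    apply hP.topCat_ext
    · rw [map_act hX]
      exact (ConcreteCategory.congr_hom (hk x'.map e.map (congrArg Hom.map h)) PUnit.unit).trans hxy
    · exact ConcreteCategory.congr_hom (congrArg Hom.map (D.act_hom x' e h)) PUnit.unit
  exact (toBase_le hX (D.act x' e h) PUnit.unit).trans_eq (congrArg D.obj.toBase hy)

variable (σ f) in
/-- The second condition of the theorem: the smallest convergence point of the
image of an ultrafilter `𝔟` converging to `b` is the supremum of those coming from the lifts of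
`𝔟` and `b` along `f`. -/
def LiftsConvergence : Prop :=
  ∀ (𝔟 : Ultrafilter B.space) (b : B.space), (𝔟 : Filter B.space) ≤ 𝓝 b →
    σ (𝔟.map B.toBase) =
      ⨆ (𝔞 : Ultrafilter A.space) (a : A.space) (_ : (𝔞 : Filter A.space) ≤ 𝓝 a)
        (_ : 𝔞.map f.map = 𝔟) (_ : f.map a = b), σ (𝔞.map A.toBase)

/-- The condition at principal ultrafilters: `β` is the fibrewise supremum of `α`. -/
theorem LiftsConvergence.toBase_le_iSup (hX : IsTopologicalInfSemilattice X)
    (hσ : BinaryInfPreservesSmallestConvergencePoints σ) (h : LiftsConvergence σ f)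
    (b : B.space) : B.toBase b ≤ ⨆ (a : A.space) (_ : f.map a = b), A.toBase a := by
  have := h (pure b) b (pure_le_nhds b)
  rw [Ultrafilter.map_pure, hσ.isLeftAdjointOfUnit.apply_pure hX] at this
  rw [this]
  refine iSup_le fun 𝔞 => iSup_le fun a => iSup_le fun ha => iSup_le fun _ => iSup_le fun hab => ?_
  exact (hσ.isLeftAdjointOfUnit.continuous_iff.1 A.toBase.continuous 𝔞 a ha).trans
    (le_iSup₂_of_le a hab le_rfl)

theorem descendsMorphisms_of_map (hX : IsTopologicalInfSemilattice X)
    (hf : ∀ b, B.toBase b ≤ ⨆ (a : A.space) (_ : f.map a = b), A.toBase a)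
    (h : DescendsMorphisms f.map) : DescendsMorphisms f := by
  intro P Q Q' k d π π' hP w hw hc
  have hP' := isPullback_map hX hP
  obtain ⟨v, ⟨hv, hkv⟩, hu⟩ := h π'.map hP' w.map (congrArg Hom.map hw) fun x y hxy =>
    congrArg Hom.map (hc (ofBot hX x) (ofBot hX y) (hom_ext hxy))
  have hle (q : Q.space) : Q.toBase q ≤ Q'.toBase (v q) := by
    rw [← inf_eq_left.2 ((toBase_le hX π q).trans (hf (π.map q))), inf_iSup₂_eq]
    refine iSup₂_le fun a ha => ?_
    obtain ⟨x, rfl, rfl⟩ := hP'.topCat_exists q a ha.symm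
    refine (inf_le_of_isPullback hX hP x).trans ((toBase_le hX w x).trans_eq ?_)
    exact congrArg Q'.toBase (ConcreteCategory.congr_hom hkv x).symm
  refine ⟨ofLe hX v hle, ⟨hom_ext hv, hom_ext hkv⟩, ?_⟩
  rintro v₁ ⟨hv₁, hkv₁⟩
  exact hom_ext (hu v₁.map ⟨congrArg Hom.map hv₁, congrArg Hom.map hkv₁⟩)

theorem descendsObjects_of_map (hX : IsTopologicalInfSemilattice X)
    (hσ : BinaryInfPreservesSmallestConvergencePoints σ) (hf : LiftsConvergence σ f)
    (h : DescendsObjects f.map) : DescendsObjects f := by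
  intro D
  obtain ⟨Q, π, k, hP, hk⟩ := h (mapDescentDatum hX D)
  change D.obj.space ⟶ Q at k
  change IsPullback k D.hom.map π f.map at hP
  let κ (q : Q) : X := ⨆ (x : D.obj.space) (_ : k x = q), D.obj.toBase x
  have hcκ (x : D.obj.space) : D.obj.toBase x ≤ κ (k x) := le_iSup₂_of_le x rfl le_rfl
  have hκc (x : D.obj.space) : κ (k x) ⊓ A.toBase (D.hom.map x) ≤ D.obj.toBase x := by
    rw [inf_comm, inf_iSup₂_eq]
    exact iSup₂_le fun y hy => inf_le_of_descentDatum hX D hP hk y x hy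
  have hκβ (q : Q) : κ q ≤ B.toBase (π q) := by
    refine iSup₂_le fun x hx => ?_
    subst hx
    exact ((toBase_le hX D.hom x).trans (toBase_le hX f _)).trans_eq
      (congrArg B.toBase (hP.topCat_condition x).symm)
  have hκ : Continuous κ := by
    rw [hσ.isLeftAdjointOfUnit.continuous_iff]
    intro 𝔮 q hq
    have hb : σ (𝔮.map κ) ≤ σ ((𝔮.map π).map B.toBase) :=
      hσ.isLeftAdjointOfUnit.map_mono hX hκβ 𝔮
    -- By distributivity, it suffices to bound `σ (κ 𝔮) ⊓ σ (α 𝔞)` for the lifts `𝔞` of `π 𝔮`.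
    rw [← inf_eq_left.2 hb, hf (𝔮.map π) (π q) ((Filter.map_mono hq).trans
      π.hom.continuous.continuousAt)]
    simp only [inf_iSup_eq]
    refine iSup_le fun 𝔞 => iSup_le fun a => iSup_le fun ha => iSup_le fun h𝔞 =>
      iSup_le fun hab => ?_
    obtain ⟨𝔴, rfl, rfl⟩ := hP.topCat_exists_ultrafilter 𝔮 𝔞 h𝔞.symm
    obtain ⟨x, rfl, rfl⟩ := hP.topCat_exists q a hab.symm
    have hx := hP.topCat_le_nhds hq ha
    calc σ ((𝔴.map k).map κ) ⊓ σ ((𝔴.map D.hom.map).map A.toBase)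
        = σ (𝔴.map fun x => κ (k x) ⊓ A.toBase (D.hom.map x)) := (hσ.map_inf_map _ _ 𝔴).symm
      _ ≤ σ (𝔴.map D.obj.toBase) := hσ.isLeftAdjointOfUnit.map_mono hX hκc 𝔴
      _ ≤ D.obj.toBase x :=
        hσ.isLeftAdjointOfUnit.continuous_iff.1 D.obj.toBase.continuous 𝔴 x hx
      _ ≤ κ (k x) := hcκ x
  let Q' : LaxCommaTop X := ⟨Q, ⟨κ, hκ⟩⟩
  let π' : Q' ⟶ B := ofLe hX π hκβ
  let k' : D.obj ⟶ Q' := ofLe hX k hcκ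
  refine ⟨Q', π', k', isPullback_of_map (π := π') (k := k') hX hP hκc,
    fun {T} x e he => hom_ext ?_⟩
  rw [comp_map, map_act hX]
  exact hk x.map e.map _

/-! ### Necessity of the second condition -/

/-- The space of an ultrafilter and a limit of it: the discrete space `Z` with an additional point,
to which `𝔟` converges. -/
def AdjoinLimit {Z : Type u} (_ : Ultrafilter Z) : Type u := Option Z

namespace AdjoinLimit

variable {Z : Type u} {𝔟 : Ultrafilter Z}

/-- The inclusion of the discrete part. -/
def point (z : Z) : AdjoinLimit 𝔟 := some z

/-- The adjoined limit of `𝔟`. -/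
def limit : AdjoinLimit 𝔟 := none

instance : TopologicalSpace (AdjoinLimit 𝔟) :=
  nhdsAdjoint limit (Filter.map point 𝔟)

/-- The function on `AdjoinLimit 𝔟` with value `y` at the limit and values `g` elsewhere. -/
def extend {Y : Type*} (y : Y) (g : Z → Y) (q : AdjoinLimit 𝔟) : Y := Option.elim q y g

theorem nhds_limit : 𝓝 (limit : AdjoinLimit 𝔟) = pure limit ⊔ Filter.map point 𝔟 :=
  nhds_nhdsAdjoint_same limit _

theorem continuous_extend {Y : Type*} [TopologicalSpace Y] {y : Y} {g : Z → Y}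
    (h : Filter.Tendsto g 𝔟 (𝓝 y)) : Continuous (extend y g : AdjoinLimit 𝔟 → Y) :=
  continuous_nhdsAdjoint_dom.2 h

theorem map_point_le_nhds :
    ((𝔟.map point : Ultrafilter (AdjoinLimit 𝔟)) : Filter (AdjoinLimit 𝔟)) ≤ 𝓝 limit :=
  le_sup_right.trans_eq nhds_limit.symm

theorem eq_of_le_nhds {𝔮 : Ultrafilter (AdjoinLimit 𝔟)}
    (h : (𝔮 : Filter (AdjoinLimit 𝔟)) ≤ 𝓝 limit) :
    𝔮 = pure limit ∨ 𝔮 = 𝔟.map point := by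
  rw [nhds_limit] at h
  exact (Ultrafilter.le_sup_iff.1 h).imp (fun h => Ultrafilter.eq_of_le h)
    fun h => Ultrafilter.eq_of_le (g := 𝔟.map point) h

end AdjoinLimit

/-- Descent of morphisms makes `β b` the supremum of `α` over the fibre: the one-point objects over
`b` with these two values have the same pullback along `f`. -/
theorem toBase_le_iSup_of_descendsMorphisms (hX : IsTopologicalInfSemilattice X)
    [HasPullbacksAlong f] (h : DescendsMorphisms f) (b : B.space) :
    B.toBase b ≤ ⨆ (a : A.space) (_ : f.map a = b), A.toBase a := by
  set s := ⨆ (a : A.space) (_ : f.map a = b), A.toBase a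
  have hsb : s ≤ B.toBase b := iSup₂_le fun a ha => (toBase_le hX f a).trans_eq (by rw [ha])
  let pt : TopCat.{u} := TopCat.of PUnit
  let π : const pt (B.toBase b) ⟶ B := ofLe hX (TopCat.ofHom (.const _ b)) fun _ => le_rfl
  let π' : const pt s ⟶ B := ofLe hX (TopCat.ofHom (.const _ b)) fun _ => hsb
  have hP := IsPullback.of_hasPullback π f
  let w : pullback π f ⟶ const pt s := ofLe hX (TopCat.ofHom (.const _ PUnit.unit)) fun x =>
    (toBase_le hX (pullback.snd π f) x).trans
      (le_iSup₂_of_le _ ((isPullback_map hX hP).topCat_condition x).symm le_rfl)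
  obtain ⟨v, -⟩ := h π' hP w (hom_ext rfl) fun x y _ => hom_ext rfl
  exact toBase_le hX v PUnit.unit

/-- Descent tested on `AdjoinLimit 𝔟` forces the second condition. -/
theorem liftsConvergence_of_descends (hX : IsTopologicalInfSemilattice X)
    (hσ : BinaryInfPreservesSmallestConvergencePoints σ)
    [HasPullbacksAlong f] (hm : DescendsMorphisms f) (ho : DescendsObjects f) :
    LiftsConvergence σ f := by
  intro 𝔟 b hb
  have hσ' := hσ.isLeftAdjointOfUnit
  set s := ⨆ (𝔞 : Ultrafilter A.space) (a : A.space) (_ : (𝔞 : Filter A.space) ≤ 𝓝 a)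
        (_ : 𝔞.map f.map = 𝔟) (_ : f.map a = b), σ (𝔞.map A.toBase)
  apply le_antisymm
  swap
  · refine iSup_le fun 𝔞 => iSup_le fun a => iSup_le fun _ => iSup_le fun h𝔞 => iSup_le fun _ => ?_
    rw [← h𝔞]
    exact hσ'.map_mono hX (toBase_le hX f) 𝔞
  let Z : TopCat.{u} := TopCat.of (AdjoinLimit 𝔟)
  let π : Z ⟶ B.space := TopCat.ofHom ⟨AdjoinLimit.extend b id, AdjoinLimit.continuous_extend hb⟩
  let g : Z → X := AdjoinLimit.extend (𝔟 := 𝔟) s fun _ => ⊤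
  have hP := TopCat.isPullback_pullbackFst_pullbackSnd π f.map
  let P : TopCat.{u} := TopCat.of {x : Z × A.space // π x.1 = f.map x.2}
  let k : P ⟶ Z := TopCat.pullbackFst π f.map
  let d : P ⟶ A.space := TopCat.pullbackSnd π f.map
  change IsPullback k d π f.map at hP
  have hα {𝔞 : Ultrafilter A.space} {a : A.space} (ha : (𝔞 : Filter A.space) ≤ 𝓝 a) :
      σ (𝔞.map A.toBase) ≤ A.toBase a := hσ'.continuous_iff.1 A.toBase.continuous 𝔞 a ha
  -- The value `s` at the adjoined point is just large enough for continuity.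
  have hc : Continuous fun x : P => g (k x) ⊓ A.toBase (d x) := by
    rw [hσ'.continuous_iff]
    intro 𝔴 x hx
    have hk : ((𝔴.map k : Ultrafilter _) : Filter Z) ≤ 𝓝 (k x) :=
      (Filter.map_mono hx).trans k.hom.continuous.continuousAt
    have hd : ((𝔴.map d : Ultrafilter _) : Filter A.space) ≤ 𝓝 (d x) :=
      (Filter.map_mono hx).trans d.hom.continuous.continuousAt
    have hw : (𝔴.map k).map π = (𝔴.map d).map f.map :=
      congrArg (fun u : P → B.space => 𝔴.map u) (funext hP.topCat_condition)
    rw [hσ.map_inf_map (fun x => g (k x)) (fun x => A.toBase (d x)) 𝔴]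
    refine le_inf ?_ (inf_le_right.trans (hα hd))
    change σ ((𝔴.map k).map g) ⊓ σ ((𝔴.map d).map A.toBase) ≤ g (k x)
    have hx' := hP.topCat_condition x
    generalize k x = q at hk hx' ⊢
    cases q with
    | some y => exact le_top
    | none =>
      rcases AdjoinLimit.eq_of_le_nhds hk with h | h
      · rw [h, Ultrafilter.map_pure, hσ'.apply_pure hX]
        exact inf_le_left
      · rw [h] at hw
        exact inf_le_right.trans (le_iSup_of_le (𝔴.map d) <| le_iSup_of_le (d x) <|
          le_iSup_of_le hd <| le_iSup_of_le hw.symm <| le_iSup_of_le hx'.symm le_rfl)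
  let L : LaxCommaTop X := ⟨P, ⟨_, hc⟩⟩
  let D : DescentDatum f := liftDescentDatum hX (DescentDatum.ofIsPullback hP) ⟨_, hc⟩
    (fun _ => inf_le_right) fun x e h t => by
      have hx : (x ≫ k) ≫ π = e ≫ f.map :=
        (Category.assoc _ _ _).trans ((congrArg (x ≫ ·) hP.w).trans h)
      refine le_inf ((inf_le_left.trans inf_le_left).trans_eq ?_) (inf_le_right.trans_eq ?_)
      · exact congrArg g (ConcreteCategory.congr_hom (hP.lift_fst (x ≫ k) e hx) t).symm
      · exact congrArg A.toBase (ConcreteCategory.congr_hom (hP.lift_snd (x ≫ k) e hx) t).symm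
  obtain ⟨Q, ρ, j, hQ, hj⟩ := ho D
  -- `Q` may differ from `Z`, but its structure map can be restricted to `Z` along `v`.
  obtain ⟨v, ⟨hv, hkv⟩, -⟩ := descendsMorphisms_map hX hm ρ.map hP j.map
    (congrArg Hom.map hQ.w |>.trans hP.w.symm) (by
      intro T x y hxy
      have hact : x ≫ d ≫ f.map = (y ≫ d) ≫ f.map := by
        rw [Category.assoc, ← hP.w, reassoc_of% hxy]
      have h1 := congrArg Hom.map
        (hj (ofBot hX (A := L) x) (ofBot hX (A := A) (y ≫ d)) (hom_ext hact))
      refine h1.symm.trans (congrArg (· ≫ j.map) ?_)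
      exact hP.hom_ext ((hP.lift_fst _ _ _).trans hxy) (hP.lift_snd _ _ _))
  let κ (q : Z) : X := Q.toBase (v q)
  have hκ : Continuous κ := Q.toBase.continuous.comp v.hom.continuous
  have hκβ (q : Z) : κ q ≤ B.toBase (π q) :=
    (toBase_le hX ρ (v q)).trans_eq (congrArg B.toBase (ConcreteCategory.congr_hom hv q))
  have hjv (x : P) : j.map x = v (k x) := (ConcreteCategory.congr_hom hkv x).symm
  have hgκ (q : Z) (a : A.space) (ha : f.map a = π q) :
      g q ⊓ A.toBase a ≤ κ q := by
    obtain ⟨x, rfl, rfl⟩ := hP.topCat_exists q a ha.symm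
    exact (toBase_le hX j x).trans_eq (congrArg Q.toBase (hjv x))
  have hκg (q : Z) (a : A.space) (ha : f.map a = π q) :
      κ q ⊓ A.toBase a ≤ g q := by
    obtain ⟨x, rfl, rfl⟩ := hP.topCat_exists q a ha.symm
    have := inf_le_of_isPullback hX hQ x
    rw [hjv] at this
    exact this.trans inf_le_left
  have hβ := toBase_le_iSup_of_descendsMorphisms hX hm
  have hsome (y : B.space) : B.toBase y ≤ κ (AdjoinLimit.point (𝔟 := 𝔟) y) := by
    refine (hβ y).trans (iSup₂_le fun a ha => ?_)
    exact (le_inf le_top le_rfl).trans (hgκ (AdjoinLimit.point (𝔟 := 𝔟) y) a ha)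
  have hnone : κ (AdjoinLimit.limit (𝔟 := 𝔟)) ≤ s := by
    rw [← inf_eq_left.2 ((hκβ (AdjoinLimit.limit (𝔟 := 𝔟))).trans (hβ b)), inf_iSup₂_eq]
    exact iSup₂_le fun a ha => hκg (AdjoinLimit.limit (𝔟 := 𝔟)) a ha
  calc σ (𝔟.map B.toBase) ≤ σ (𝔟.map fun y => κ (AdjoinLimit.point (𝔟 := 𝔟) y)) :=
        hσ'.map_mono hX hsome 𝔟
    _ ≤ κ (AdjoinLimit.limit (𝔟 := 𝔟)) := hσ'.continuous_iff.1 hκ (𝔟.map AdjoinLimit.point) _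
        AdjoinLimit.map_point_le_nhds
    _ ≤ s := hnone

end LaxCommaTop

theorem theoremd {X : Type u} [TopologicalSpace X] [Order.Frame X]
    (hX : IsTopologicalInfSemilattice X)
    (σ : Ultrafilter X → X) (hσ : BinaryInfPreservesSmallestConvergencePoints σ)
    {A B : LaxCommaTop X} (f : A ⟶ B) :
    IsEffectiveDescent f ↔
      IsEffectiveDescent f.map ∧
      ∀ (𝔟 : Ultrafilter B.space) (b : B.space), (𝔟 : Filter B.space) ≤ 𝓝 b →
        σ (𝔟.map B.toBase) =
          ⨆ (𝔞 : Ultrafilter A.space) (a : A.space) (_ : (𝔞 : Filter A.space) ≤ 𝓝 a)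
            (_ : 𝔞.map f.map = 𝔟) (_ : f.map a = b), σ (𝔞.map A.toBase) := by
  change IsEffectiveDescent f ↔ IsEffectiveDescent f.map ∧ LaxCommaTop.LiftsConvergence σ f
  rw [isEffectiveDescent_iff, isEffectiveDescent_iff]
  constructor
  · rintro ⟨_, hm, ho⟩
    exact ⟨⟨inferInstance, LaxCommaTop.descendsMorphisms_map hX hm,
      LaxCommaTop.descendsObjects_map hX ho⟩,
      LaxCommaTop.liftsConvergence_of_descends hX hσ hm ho⟩
  · rintro ⟨⟨_, hm, ho⟩, h⟩
    exact ⟨LaxCommaTop.hasPullbacksAlong hX hσ f,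
      LaxCommaTop.descendsMorphisms_of_map hX (h.toBase_le_iSup hX hσ) hm,
      LaxCommaTop.descendsObjects_of_map hX hσ h ho⟩
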